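/- Let $K$ be a field of characteristic zero (for example $\mathbb{C}$). For $n\ge 0$, a meander with $n$ nodes is a pair $\frac{\lambda}{\mu}$ of compositions $\lambda,\mu$ of $n$. Its associated seaweed algebra $\mathfrak{p}_n\frac{\lambda}{\mu}\subseteq\mathfrak{gl}_n(K)$ is the Lie subalgebra of all matrices whose nonzero entries above the diagonal lie in the diagonal blocks of sizes $\lambda_1,\lambda_2,\ldots$ and whose nonzero entries below the diagonal lie in the diagonal blocks of sizes $\mu_1,\mu_2,\ldots$. The index of $\frac{\lambda}{\mu}$ is the index of the Lie algebra $\mathfrak{g}=\mathfrak{p}_n\frac{\lambda}{\mu}$, that is, $\min_{f\in\mathfrak{g}^*}\dim\{x\in\mathfrak{g} : f([x,y])=0 \text{ for all } y\in\mathfrak{g}\}$. For a set $J$ of positive integers let $a^J_{n,k}$ be the number of meanders $\frac{\lambda}{\mu}$ with $n$ nodes and index $k$ such that all parts of $\lambda$ and $\mu$ belong to $J$, and let $A_J(x,y)=\sum_{n,k\ge 0}a^J_{n,k}x^ny^k$ as a formal power series. Theorem. We have \[ A_{\{1,2\}}(x,y)=\frac{1-x}{(1-xy-x^2y^2)(1-x)-2x^2y},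 \] and $A_{\{c,2c\}}(x,y)=A_{\{1,2\}}(x^c,y^c)$ for every integer $c\ge 1$. -/

import Mathlib

noncomputable section

attribute [local instance] LieRing.ofAssociativeRing

/-- The stabilizer `𝔤_f = {x ∈ 𝔤 | f ⁅x, y⁆ = 0 for all y ∈ 𝔤}` of a linear form `f` on a Lie
algebra under the coadjoint action. -/
def coadjointStabilizer {K L : Type*} [Field K] [LieRing L] [LieAlgebra K L]
    (f : Module.Dual K L) : Submodule K L where
  carrier := {x | ∀ y : L, f ⁅x, y⁆ = 0}
  zero_mem' := by
    intro y
    simp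
  add_mem' := by
    intro a b ha hb y
    rw [add_lie, map_add, ha y, hb y, add_zero]
  smul_mem' := by
    intro t a ha y
    rw [smul_lie, map_smul, ha y, smul_zero]

/-- The index of a finite-dimensional Lie algebra: the minimum, over all linear forms `f`, of the
dimension of the stabilizer of `f`. -/
def lieIndex (K L : Type*) [Field K] [LieRing L] [LieAlgebra K L] : ℕ :=
  ⨅ f : Module.Dual K L, Module.finrank K (coadjointStabilizer f)

/-- The blocks of a composition of `n` are intervals of `{0, …, n - 1}`. -/
theorem Composition.index_eq_of_between {n : ℕ} (c : Composition n) {i k j : Fin n}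
    (hik : i ≤ k) (hkj : k ≤ j) (h : c.index i = c.index j) :
    c.index i = c.index k ∧ c.index k = c.index j := by
  have mono : ∀ a b : Fin n, a ≤ b → c.index a ≤ c.index b := by
    intro a b hab
    by_contra hlt
    have h1 : c.sizeUpTo (c.index b).succ ≤ c.sizeUpTo (c.index a) :=
      c.monotone_sizeUpTo (Nat.succ_le_of_lt (not_le.mp hlt))
    have h2 := c.lt_sizeUpTo_index_succ b
    have h3 := c.sizeUpTo_index_le a
    have h4 : (a : ℕ) ≤ b := hab
    omega
  have h1 := mono i k hik
  have h2 := mono k j hkj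
  rw [← h] at h2
  have h3 := le_antisymm h1 h2
  exact ⟨h3, h3.symm.trans h⟩

/-- A meander with `n` nodes: a pair `λ / μ` of compositions of `n`. -/
structure Meander (n : ℕ) where
  upper : Composition n
  lower : Composition n

namespace Meander

instance {n : ℕ} : Finite (Meander n) :=
  Finite.of_injective (fun m : Meander n => (m.upper, m.lower)) (by
    rintro ⟨a, b⟩ ⟨c, d⟩ h
    cases h
    rfl)

/-- A matrix has seaweed shape `λ / μ` if its nonzero entries above the diagonal lie in the
diagonal blocks given by `λ`, and those below the diagonal in the diagonal blocks given by `μ`. -/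
def HasShape {n : ℕ} {K : Type*} [Field K] (m : Meander n) (M : Matrix (Fin n) (Fin n) K) : Prop :=
  (∀ i j, i < j → M i j ≠ 0 → m.upper.index i = m.upper.index j) ∧
  (∀ i j, j < i → M i j ≠ 0 → m.lower.index i = m.lower.index j)

theorem HasShape.mul {n : ℕ} {K : Type*} [Field K] {m : Meander n}
    {M N : Matrix (Fin n) (Fin n) K} (hM : m.HasShape M) (hN : m.HasShape N) :
    m.HasShape (M * N) := by
  constructor
  · intro i j hij hne
    rw [Matrix.mul_apply] at hne
    obtain ⟨k, -, hk⟩ := Finset.exists_ne_zero_of_sum_ne_zero hne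
    have hk1 := left_ne_zero_of_mul hk
    have hk2 := right_ne_zero_of_mul hk
    rcases lt_trichotomy i k with h1 | h1 | h1
    · rcases lt_trichotomy k j with h2 | h2 | h2
      · exact (hM.1 i k h1 hk1).trans (hN.1 k j h2 hk2)
      · exact h2 ▸ hM.1 i k h1 hk1
      · exact (m.upper.index_eq_of_between hij.le h2.le (hM.1 i k h1 hk1)).1
    · exact h1 ▸ hN.1 k j (h1 ▸ hij) hk2
    · exact (m.upper.index_eq_of_between h1.le hij.le (hN.1 k j (h1.trans hij) hk2)).2
  · intro i j hij hne
    rw [Matrix.mul_apply] at hne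
    obtain ⟨k, -, hk⟩ := Finset.exists_ne_zero_of_sum_ne_zero hne
    have hk1 := left_ne_zero_of_mul hk
    have hk2 := right_ne_zero_of_mul hk
    rcases lt_trichotomy k i with h1 | h1 | h1
    · rcases lt_trichotomy j k with h2 | h2 | h2
      · exact (hM.2 i k h1 hk1).trans (hN.2 k j h2 hk2)
      · exact h2 ▸ hM.2 i k h1 hk1
      · exact (m.lower.index_eq_of_between h2.le hij.le (hM.2 i k h1 hk1).symm).2.symm
    · exact h1 ▸ hN.2 k j (h1.symm ▸ hij) hk2
    · exact (m.lower.index_eq_of_between hij.le h1.le (hN.2 k j (hij.trans h1) hk2).symm).1.symm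

/-- The seaweed subalgebra of `𝔤𝔩ₙ(K)` associated to the meander `λ / μ`. -/
def seaweed (K : Type*) [Field K] {n : ℕ} (m : Meander n) :
    LieSubalgebra K (Matrix (Fin n) (Fin n) K) where
  carrier := {M | m.HasShape M}
  zero_mem' := ⟨fun _ _ _ h => absurd rfl h, fun _ _ _ h => absurd rfl h⟩
  add_mem' := by
    intro M N hM hN
    constructor
    · intro i j hij hne
      by_cases h : M i j = 0
      · exact hN.1 i j hij fun h' => hne (by rw [Matrix.add_apply, h, h', add_zero])
      · exact hM.1 i j hij h
    · intro i j hij hne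
      by_cases h : M i j = 0
      · exact hN.2 i j hij fun h' => hne (by rw [Matrix.add_apply, h, h', add_zero])
      · exact hM.2 i j hij h
  smul_mem' := by
    intro t M hM
    exact ⟨fun i j hij hne => hM.1 i j hij (right_ne_zero_of_mul hne),
      fun i j hij hne => hM.2 i j hij (right_ne_zero_of_mul hne)⟩
  lie_mem' := by
    intro M N hM hN
    have h1 := HasShape.mul hM hN
    have h2 := HasShape.mul hN hM
    constructor
    · intro i j hij hne
      rw [Ring.lie_def, Matrix.sub_apply] at hne
      by_cases h : (M * N) i j = 0
      · exact h2.1 i j hij fun h' => hne (by rw [h, h', sub_zero])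
      · exact h1.1 i j hij h
    · intro i j hij hne
      rw [Ring.lie_def, Matrix.sub_apply] at hne
      by_cases h : (M * N) i j = 0
      · exact h2.2 i j hij fun h' => hne (by rw [h, h', sub_zero])
      · exact h1.2 i j hij h

/-- The index of a meander: the index of the associated seaweed algebra over `K`. -/
def index (K : Type*) [Field K] {n : ℕ} (m : Meander n) : ℕ :=
  lieIndex K (m.seaweed K)

/-- All parts of both compositions of the meander belong to `J`. -/
def PartsIn {n : ℕ} (m : Meander n) (J : Set ℕ) : Prop :=
  (∀ b ∈ m.upper.blocks, b ∈ J) ∧ (∀ b ∈ m.lower.blocks, b ∈ J)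

end Meander

/-- The number of meanders with `n` nodes, parts in `J` and index `k`. -/
def meanderCount (K : Type*) [Field K] (J : Set ℕ) (n k : ℕ) : ℕ :=
  Set.ncard {m : Meander n | m.PartsIn J ∧ m.index K = k}

/-- The generating function `A_J(x, y)`, the sum of `a x ^ n y ^ k` over all `n` and `k`, with `a`
the number of meanders with `n` nodes, parts in `J` and index `k`. The variable `x` has number `0`
and `y` has number `1`. -/
def meanderGF (K : Type*) [Field K] (J : Set ℕ) : MvPowerSeries (Fin 2) ℚ :=
  fun e => (meanderCount K J (e 0) (e 1) : ℚ)

end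

/-!
The index of a seaweed algebra whose parts are `c` and `2 * c` is computed by reading the two
compositions from the left, and the counting recursion that results is linear.

* Equal leading parts `a` split off a direct summand `𝔤𝔩_a`. The index is additive on direct sums
  (`lieIndex_of_prod`) and the index of `𝔤𝔩_a` is `a` (`lieIndex_matrix`).
* If one leading part is `a` and the other is `2 * a`, the seaweed algebra is a semidirect product
  `(𝔤𝔩_a × H) ⋉ Hom(K ^ a, K ^ a)` with an abelian ideal, where `H` is the seaweed algebra obtained
  by deleting the first `a` rows and columns. The stabilizer of a form which is nondegenerate on
  the ideal is isomorphic to that of some form on `H`, and every form on `H` occurs, so the index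
  does not change (`lieIndex_of_semidirect`).

Lower bounds for the index concern all linear forms. They are proved for generic forms only: the
dimension of the stabilizer is upper semicontinuous along lines in the dual, and the field is
infinite (`le_lieIndex_of_finite`).

Hence the index is `reductionIndex` of the two lists of parts (`Meander.index_eq_reductionIndex`),
which is multiplied by `c` when all parts are. This gives the second part of the theorem.

For the first part, let `A` be the generating function and let `x P` be the one of the pairs whose
second composition begins with `1`. Sorting pairs by their leading parts `1 / 1`, `2 / 2`, `1 / 2`
and `2 / 1`, and using the symmetry of the index, one finds `A = 1 + x y A + x² y² A + 2 x² P` and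
`P = y A + x P`. Eliminating `P` yields the formula.
-/

attribute [local instance] LieRing.ofAssociativeRing

open Polynomial Module

/-! ### Generic linear independence and semicontinuity -/

/-- A family of vectors depending polynomially on a parameter is linearly independent at all but
finitely many parameters as soon as it is at one: some minor is a nonzero polynomial. -/
theorem finite_setOf_not_linearIndependent {K V ι : Type*} [Field K] [AddCommGroup V] [Module K V]
    [Fintype ι] (w : ι → K → V)
    (hw : ∀ (φ : Dual K V) (i : ι), ∃ p : K[X], ∀ t, φ (w i t) = p.eval t) {t₀ : K}
    (h : LinearIndependent K fun i => w i t₀) :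
    {t | ¬ LinearIndependent K fun i => w i t}.Finite := by
  classical
  obtain ⟨g, hg⟩ := LinearMap.exists_leftInverse_of_injective
    (Fintype.linearCombination K fun i => w i t₀)
    (LinearMap.ker_eq_bot.2 (h.fintypeLinearCombination_injective))
  choose p hp using fun j i => hw ((LinearMap.proj j : (ι → K) →ₗ[K] K) ∘ₗ g) i
  have hdet : ∀ t, (Matrix.of p).det.eval t = (Matrix.of fun j i => g (w i t) j).det := by
    intro t
    rw [← Polynomial.coe_evalRingHom, RingHom.map_det]
    congr 1
    ext j i
    simpa using (hp j i t).symm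
  have h₀ : (Matrix.of fun j i => g (w i t₀) j) = 1 := by
    ext j i
    have := congrFun (LinearMap.congr_fun hg (Pi.single i 1)) j
    simpa [Fintype.linearCombination_apply_single, Matrix.one_apply, Pi.single_apply] using this
  have hne : (Matrix.of p).det ≠ 0 := by
    intro h0
    have := hdet t₀
    rw [h₀, h0] at this
    simp at this
  refine ((Matrix.of p).det.roots.toFinset.finite_toSet).subset ?_
  intro t ht
  simp only [Finset.mem_coe, Multiset.mem_toFinset, mem_roots hne, IsRoot.def]
  by_contra hne'
  refine ht (Fintype.linearIndependent_iff.2 fun c hc => ?_)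
  rw [hdet] at hne'
  refine congrFun (Matrix.eq_zero_of_mulVec_eq_zero hne' ?_)
  ext j
  have := congrFun (congrArg g hc) j
  simpa [Matrix.mulVec, dotProduct, mul_comm] using this

/-- Along a line of linear maps the dimension of the kernel is upper semicontinuous. -/
theorem finite_setOf_finrank_ker_lt {K V W : Type*} [Field K] [AddCommGroup V] [Module K V]
    [AddCommGroup W] [Module K W] [FiniteDimensional K V] (A B : V →ₗ[K] W) :
    {t : K | finrank K (LinearMap.ker A) < finrank K (LinearMap.ker (A + t • B))}.Finite := by
  let b := finBasis K (LinearMap.range A)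
  choose x hx using fun i => (b i).2
  have hli : LinearIndependent K fun i => A (x i) := by
    simp_rw [hx]
    exact b.linearIndependent.map' (Submodule.subtype _) (Submodule.ker_subtype _)
  refine (finite_setOf_not_linearIndependent (fun i t => A (x i) + t • B (x i)) (t₀ := 0) ?_
    (by simpa using hli)).subset ?_
  · exact fun φ i => ⟨C (φ (A (x i))) + X * C (φ (B (x i))), fun t => by simp [mul_comm t]⟩
  · intro t ht h
    have h1 : LinearIndependent K fun i => (⟨(A + t • B) (x i), x i, rfl⟩ :
        LinearMap.range (A + t • B)) := by
      refine LinearIndependent.of_comp (Submodule.subtype _) ?_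
      simpa [Function.comp_def] using h
    have h2 := h1.fintype_card_le_finrank
    rw [Fintype.card_fin] at h2
    have h3 := LinearMap.finrank_range_add_finrank_ker A
    have h4 := LinearMap.finrank_range_add_finrank_ker (A + t • B)
    have h5 : finrank K (LinearMap.ker A) < finrank K (LinearMap.ker (A + t • B)) := ht
    omega

/-! ### The index of a Lie algebra -/

section Index

variable {K L : Type*} [Field K] [LieRing L] [LieAlgebra K L]

theorem mem_coadjointStabilizer {f : Dual K L} {x : L} :
    x ∈ coadjointStabilizer f ↔ ∀ y : L, f ⁅x, y⁆ = 0 := Iff.rfl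

/-- The alternating form `(x, y) ↦ f ⁅x, y⁆`, whose kernel is the stabilizer of `f`. -/
def bracketForm (f : Dual K L) : L →ₗ[K] Dual K L :=
  LinearMap.mk₂ K (fun x y => f ⁅x, y⁆) (by simp) (by simp) (by simp) (by simp)

theorem ker_bracketForm (f : Dual K L) :
    LinearMap.ker (bracketForm f) = coadjointStabilizer f := by
  ext x
  rw [LinearMap.mem_ker, LinearMap.ext_iff]
  rfl

/-- The dimension of the stabilizer is upper semicontinuous along lines in the dual. -/
theorem finite_setOf_finrank_coadjointStabilizer_lt [FiniteDimensional K L] (f g : Dual K L) :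
    {t : K | finrank K (coadjointStabilizer f) <
      finrank K (coadjointStabilizer (f + t • g))}.Finite := by
  have h := finite_setOf_finrank_ker_lt (bracketForm f) (bracketForm g)
  have h' : ∀ t : K, bracketForm f + t • bracketForm g = bracketForm (f + t • g) := by
    intro t
    ext x y
    simp [bracketForm]
  refine h.subset fun t ht => ?_
  rw [Set.mem_ofPred_eq, h', ker_bracketForm, ker_bracketForm]
  exact ht

theorem lieIndex_le (f : Dual K L) : lieIndex K L ≤ finrank K (coadjointStabilizer f) :=
  ciInf_le (OrderBot.bddBelow _) f

variable (K L) in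
theorem exists_finrank_eq_lieIndex :
    ∃ f : Dual K L, finrank K (coadjointStabilizer f) = lieIndex K L :=
  Nat.sInf_mem (Set.range_nonempty _)

theorem le_lieIndex {k : ℕ} (h : ∀ f : Dual K L, k ≤ finrank K (coadjointStabilizer f)) :
    k ≤ lieIndex K L :=
  le_ciInf h

/-- A lower bound for the index may be checked at almost every point of some line through each
linear form. -/
theorem le_lieIndex_of_finite [Infinite K] [FiniteDimensional K L] {k : ℕ}
    (h : ∀ f : Dual K L, ∃ g : Dual K L,
      {t : K | ¬ k ≤ finrank K (coadjointStabilizer (f + t • g))}.Finite) :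
    k ≤ lieIndex K L := by
  refine le_lieIndex fun f => ?_
  obtain ⟨g, hg⟩ := h f
  obtain ⟨t, ht⟩ :=
    (hg.union (finite_setOf_finrank_coadjointStabilizer_lt f g)).exists_notMem
  simp only [Set.mem_union, Set.mem_ofPred_eq, not_or, not_not, not_lt] at ht
  exact ht.1.trans ht.2

theorem LieEquiv.lieIndex_le {L' : Type*} [LieRing L'] [LieAlgebra K L'] [FiniteDimensional K L']
    (e : L ≃ₗ⁅K⁆ L') : lieIndex K L ≤ lieIndex K L' := by
  refine le_lieIndex fun f => (_root_.lieIndex_le (f ∘ₗ (e.toLinearEquiv : L →ₗ[K] L'))).trans ?_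
  refine LinearMap.finrank_le_finrank_of_injective
    (f := (e.toLinearEquiv : L →ₗ[K] L').restrict fun x hx y => ?_) ?_
  · have h1 : f (e ⁅x, e.symm y⁆) = 0 := hx (e.symm y)
    rw [LieEquiv.map_lie, e.apply_symm_apply] at h1
    exact h1
  · intro x y hxy
    exact Subtype.ext (e.injective (congrArg Subtype.val hxy))

theorem LieEquiv.lieIndex_eq {L' : Type*} [LieRing L'] [LieAlgebra K L'] [FiniteDimensional K L]
    [FiniteDimensional K L'] (e : L ≃ₗ⁅K⁆ L') : lieIndex K L = lieIndex K L' :=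
  le_antisymm e.lieIndex_le e.symm.lieIndex_le

/-- The index is additive on direct sums. -/
theorem lieIndex_of_prod {L₁ L₂ : Type*} [LieRing L₁] [LieAlgebra K L₁] [LieRing L₂]
    [LieAlgebra K L₂] [FiniteDimensional K L₁] [FiniteDimensional K L₂] (e : (L₁ × L₂) ≃ₗ[K] L)
    (he : ∀ x y, ⁅e x, e y⁆ = e (⁅x.1, y.1⁆, ⁅x.2, y.2⁆)) :
    lieIndex K L = lieIndex K L₁ + lieIndex K L₂ := by
  have key : ∀ (f : Dual K L) (f₁ : Dual K L₁) (f₂ : Dual K L₂),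
      (∀ x, f (e x) = f₁ x.1 + f₂ x.2) → finrank K (coadjointStabilizer f) =
        finrank K (coadjointStabilizer f₁) + finrank K (coadjointStabilizer f₂) := by
    intro f f₁ f₂ hf
    have h1 : ((coadjointStabilizer f₁).prod (coadjointStabilizer f₂)).map (e : _ →ₗ[K] L) =
        coadjointStabilizer f := by
      ext z
      obtain ⟨x, rfl⟩ := e.surjective z
      have hx : e x ∈ ((coadjointStabilizer f₁).prod (coadjointStabilizer f₂)).map
          (e : _ →ₗ[K] L) ↔ x ∈ (coadjointStabilizer f₁).prod (coadjointStabilizer f₂) := by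
        simp
      rw [hx, Submodule.mem_prod]
      simp only [mem_coadjointStabilizer]
      rw [e.surjective.forall]
      simp only [he, hf]
      constructor
      · rintro ⟨h1, h2⟩ y
        rw [h1, h2, add_zero]
      · intro h
        exact ⟨fun y => by simpa using h (y, 0), fun y => by simpa using h (0, y)⟩
    rw [← h1, LinearEquiv.finrank_map_eq, ← finrank_prod,
      ← LinearMap.finrank_range_of_inj (f := (coadjointStabilizer f₁).subtype.prodMap
        (coadjointStabilizer f₂).subtype)
        (Subtype.val_injective.prodMap Subtype.val_injective),
      LinearMap.range_prodMap, Submodule.range_subtype, Submodule.range_subtype]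
  refine le_antisymm ?_ (le_lieIndex fun f => ?_)
  · obtain ⟨f₁, h₁⟩ := exists_finrank_eq_lieIndex K L₁
    obtain ⟨f₂, h₂⟩ := exists_finrank_eq_lieIndex K L₂
    rw [← h₁, ← h₂, ← key ((f₁.coprod f₂) ∘ₗ (e.symm : L →ₗ[K] L₁ × L₂)) f₁ f₂ (by simp)]
    exact lieIndex_le _
  · rw [key f (f ∘ₗ (e : _ →ₗ[K] L) ∘ₗ LinearMap.inl K L₁ L₂)
      (f ∘ₗ (e : _ →ₗ[K] L) ∘ₗ LinearMap.inr K L₁ L₂)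
      (fun x => by simp [← map_add])]
    exact add_le_add (lieIndex_le _) (lieIndex_le _)

end Index

/-! ### The general linear Lie algebra -/

/-- Every linear form on matrices is a trace form. -/
theorem exists_eq_trace_mul {K ι : Type*} [Field K] [Fintype ι] [DecidableEq ι]
    (f : Dual K (Matrix ι ι K)) : ∃ A : Matrix ι ι K, ∀ x, f x = (A * x).trace := by
  refine ⟨Matrix.of fun i j => f (Matrix.single j i 1), fun x => ?_⟩
  conv_lhs => rw [Matrix.matrix_eq_sum_single x]
  simp only [map_sum, Matrix.trace, Matrix.diag_apply, Matrix.mul_apply, Matrix.of_apply]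
  rw [Finset.sum_comm]
  refine Finset.sum_congr rfl fun i _ => Finset.sum_congr rfl fun j _ => ?_
  rw [← mul_one (x j i), ← smul_eq_mul (x j i) 1, ← Matrix.smul_single, map_smul]
  simp [mul_comm]

/-- The linear form `x ↦ tr (A x)`. -/
def traceMulForm (K : Type*) {ι : Type*} [Field K] [Fintype ι] (A : Matrix ι ι K) :
    Dual K (Matrix ι ι K) :=
  Matrix.traceLinearMap ι K K ∘ₗ LinearMap.mulLeft K A

theorem traceMulForm_apply {K ι : Type*} [Field K] [Fintype ι] (A x : Matrix ι ι K) :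
    traceMulForm K A x = (A * x).trace := rfl

theorem mem_coadjointStabilizer_traceMulForm {K ι : Type*} [Field K] [Fintype ι] [DecidableEq ι]
    (A x : Matrix ι ι K) :
    x ∈ coadjointStabilizer (traceMulForm K A) ↔ A * x = x * A := by
  have h : ∀ y, traceMulForm K A ⁅x, y⁆ = ((A * x - x * A) * y).trace := by
    intro y
    rw [traceMulForm_apply, Ring.lie_def, mul_sub, sub_mul, Matrix.trace_sub, Matrix.trace_sub,
      ← mul_assoc, ← mul_assoc, Matrix.trace_mul_cycle A y x]
  rw [mem_coadjointStabilizer]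
  simp only [h]
  rw [← sub_eq_zero (a := A * x), Matrix.ext_iff_trace_mul_right]
  simp

/-- The index of `𝔤𝔩_n` is `n`. The form `x ↦ tr (A x)` is stabilized by the centralizer of `A`.
For a diagonal `A` with distinct entries it consists of the diagonal matrices, and for generic `A`
it contains the linearly independent powers `1, A, …, A ^ (n - 1)`. -/
theorem lieIndex_matrix (K : Type*) [Field K] [CharZero K] (n : ℕ) :
    lieIndex K (Matrix (Fin n) (Fin n) K) = n := by
  let d : Fin n → K := fun i => (i : ℕ)
  have hd : Function.Injective d := fun i j h => Fin.ext (Nat.cast_injective h)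
  refine le_antisymm ?_ (le_lieIndex_of_finite fun f => ?_)
  · refine (lieIndex_le (traceMulForm K (Matrix.diagonal d))).trans ?_
    -- a matrix commuting with a diagonal matrix with distinct entries is diagonal
    have : Function.Injective ((Matrix.diagLinearMap (Fin n) K K).domRestrict
        (coadjointStabilizer (traceMulForm K (Matrix.diagonal d)))) := by
      rw [← LinearMap.ker_eq_bot, LinearMap.ker_eq_bot']
      rintro ⟨x, hx⟩ h0
      rw [mem_coadjointStabilizer_traceMulForm] at hx
      ext i j
      by_cases hij : i = j
      · subst hij
        exact congrFun h0 i
      · have h1 := congrFun (congrFun hx i) j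
        rw [Matrix.diagonal_mul, Matrix.mul_diagonal, mul_comm, ← sub_eq_zero, ← mul_sub] at h1
        exact (mul_eq_zero.1 h1).resolve_right (sub_ne_zero.2 fun h => hij (hd h))
    simpa using LinearMap.finrank_le_finrank_of_injective this
  · obtain ⟨A, hA⟩ := exists_eq_trace_mul f
    have hf : f = traceMulForm K A := LinearMap.ext hA
    refine ⟨traceMulForm K (Matrix.diagonal d - A), ?_⟩
    -- the line through `A` and the regular diagonal matrix; powers of a matrix centralize it
    let N : K → Matrix (Fin n) (Fin n) K := fun t => A + t • (Matrix.diagonal d - A)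
    have hN : ∀ t, f + t • traceMulForm K (Matrix.diagonal d - A) = traceMulForm K (N t) := by
      intro t
      rw [hf]
      ext x
      simp [traceMulForm_apply, N, add_mul]
    refine (finite_setOf_not_linearIndependent (fun (i : Fin n) t => N t ^ (i : ℕ)) (t₀ := 1)
      ?_ ?_).subset ?_
    · intro φ i
      let N' : Matrix (Fin n) (Fin n) K[X] :=
        A.map C + (X : K[X]) • (Matrix.diagonal d - A).map C
      have hN' : ∀ t, (evalRingHom t).mapMatrix N' = N t := by
        intro t
        ext a b
        simp [N', N]
      obtain ⟨B, hB⟩ := exists_eq_trace_mul φ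
      refine ⟨(B.map C * N' ^ (i : ℕ)).trace, fun t => ?_⟩
      rw [hB, ← hN', ← map_pow]
      simp [Matrix.trace, Matrix.mul_apply, eval_finsetSum]
    · have h1 : N 1 = Matrix.diagonal d := by simp [N]
      simp only [h1, Matrix.diagonal_pow]
      refine LinearIndependent.of_comp (Matrix.diagLinearMap (Fin n) K K) ?_
      have h2 := Matrix.linearIndependent_cols_of_det_ne_zero
        (Matrix.det_vandermonde_ne_zero_iff.2 hd)
      have h3 : (Matrix.diagLinearMap (Fin n) K K ∘ fun i : Fin n => Matrix.diagonal (d ^ (i : ℕ))) =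
          (Matrix.vandermonde d).col := by
        ext i j
        simp [Matrix.vandermonde]
      rw [h3]
      exact h2
    · intro t ht hli
      refine ht ?_
      rw [hN]
      have h1 : LinearIndependent K fun i : Fin n => (⟨N t ^ (i : ℕ), by
          rw [mem_coadjointStabilizer_traceMulForm, ← pow_succ, ← pow_succ']⟩ :
          coadjointStabilizer (traceMulForm K (N t))) :=
        LinearIndependent.of_comp (Submodule.subtype _) (by simpa [Function.comp_def] using hli)
      simpa using h1.fintype_card_le_finrank

/-! ### A semidirect product with the same index -/

/-- With `A = γ⁻¹ α γ`, a form with components `α` and `γ` takes on the bracket of the element with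
components `γ U γ⁻¹` and `[U, A] γ⁻¹` with any other element the value `tr (A [U, V])`, up to the
contribution of the remaining factor. -/
theorem trace_identity_of_conj {K ι : Type*} [Field K] [Fintype ι] [DecidableEq ι]
    {α γ γ' U V b w : Matrix ι ι K} (h : γ' * γ = 1) :
    (α * (γ * (U * γ') * b - b * (γ * (U * γ')))).trace +
      (γ * ((U * (γ' * α * γ) - γ' * α * γ * U) * γ' * b + U * w - w * (γ * (U * γ')) -
        V * ((U * (γ' * α * γ) - γ' * α * γ * U) * γ'))).trace =
      (γ' * α * γ * (U * V - V * U)).trace := by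
  have h' : γ * γ' = 1 := mul_eq_one_comm.1 h
  have hl : ∀ M, γ' * (γ * M) = M := fun M => by rw [← mul_assoc, h, one_mul]
  have hr : ∀ M, γ * (γ' * M) = M := fun M => by rw [← mul_assoc, h', one_mul]
  have e1 : (α * (b * (γ * (U * γ')))).trace = (γ * (U * (γ' * (α * b)))).trace := by
    rw [← mul_assoc, Matrix.trace_mul_comm]
    simp only [mul_assoc]
  have e2 : (γ * (w * (γ * (U * γ')))).trace = (γ * (U * w)).trace := by
    rw [← mul_assoc, Matrix.trace_mul_comm]
    simp only [mul_assoc, hl]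
  have e3 : ∀ M, (γ * (V * (M * γ'))).trace = (M * V).trace := by
    intro M
    rw [← mul_assoc, ← mul_assoc, Matrix.trace_mul_comm, ← mul_assoc, ← mul_assoc, h, one_mul,
      Matrix.trace_mul_comm]
  have e4 : (U * (γ' * (α * (γ * V)))).trace = (γ' * (α * (γ * (V * U)))).trace := by
    rw [Matrix.trace_mul_comm]
    simp only [mul_assoc]
  simp only [mul_sub, sub_mul, mul_add, Matrix.trace_sub, Matrix.trace_add, mul_assoc, e1, e2, hr]
  have e5 := e3 (U * (γ' * (α * γ)))
  have e6 := e3 (γ' * (α * (γ * U)))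
  simp only [mul_assoc] at e5 e6
  rw [e5, e6, e4]
  ring

/-- Let `H` act on `K ^ c` through `ρ`, and let `L = (𝔤𝔩_c × H) ⋉ Hom(K ^ c, K ^ c)`, the last
factor being an abelian ideal. Then `L` and `H` have the same index. If the component `β` of a form
on the abelian ideal is invertible, the `𝔤𝔩_c`- and the ideal component of an element of the
stabilizer are determined by its `H`-component, and the latter runs through the stabilizer of the
form `X ↦ φ X + tr (β⁻¹ α β ρ(X))`. The forms with invertible `β` are generic. -/
theorem lieIndex_of_semidirect {K L H ι : Type*} [Field K] [Infinite K] [Fintype ι]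
    [DecidableEq ι] [LieRing L] [LieAlgebra K L] [LieRing H] [LieAlgebra K H]
    [FiniteDimensional K H] (ρ : H →ₗ[K] Matrix ι ι K) (hρ : ∀ X Y, ρ ⁅X, Y⁆ = ρ X * ρ Y - ρ Y * ρ X)
    (e : (Matrix ι ι K × Matrix ι ι K × H) ≃ₗ[K] L)
    (he : ∀ a v X b w Y, ⁅e (a, v, X), e (b, w, Y)⁆ =
      e (a * b - b * a, v * b + ρ X * w - w * a - ρ Y * v, ⁅X, Y⁆)) :
    lieIndex K L = lieIndex K H := by
  have : FiniteDimensional K L := e.finiteDimensional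
  let E : (Matrix ι ι K × Matrix ι ι K × H) →ₗ[K] L := e
  let E' : L →ₗ[K] (Matrix ι ι K × Matrix ι ι K × H) := e.symm
  refine le_antisymm ?_ (le_lieIndex_of_finite fun f => ?_)
  · obtain ⟨φ, hφ⟩ := exists_finrank_eq_lieIndex K H
    -- the extension of `φ` by `α = 0` and `β = 1`
    let F : Dual K (Matrix ι ι K × Matrix ι ι K × H) :=
      LinearMap.coprod 0 (LinearMap.coprod (Matrix.traceLinearMap ι K K) φ)
    have hF : ∀ a v X, F (a, v, X) = v.trace + φ X := by simp [F]
    let f : Dual K L := F ∘ₗ E'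
    have hf : ∀ x, f (e x) = F x := by simp [f, E']
    refine (lieIndex_le f).trans (hφ ▸ ?_)
    have hst : ∀ a v X, e (a, v, X) ∈ coadjointStabilizer f →
        a = ρ X ∧ v = 0 ∧ X ∈ coadjointStabilizer φ := by
      intro a v X h
      have h' : ∀ b w Y, (v * b + ρ X * w - w * a - ρ Y * v).trace + φ ⁅X, Y⁆ = 0 := by
        intro b w Y
        rw [← hF (a * b - b * a), ← hf, ← he]
        exact h _
      have hv : v = 0 := by
        rw [Matrix.ext_iff_trace_mul_right]
        intro b
        simpa using h' b 0 0
      refine ⟨?_, hv, ?_⟩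
      · rw [Matrix.ext_iff_trace_mul_right]
        intro w
        have := h' 0 w 0
        simp only [mul_zero, zero_add, map_zero, zero_mul, sub_zero, lie_zero, add_zero,
          Matrix.trace_sub] at this
        rw [sub_eq_zero.1 this, Matrix.trace_mul_comm]
      · intro Y
        simpa [hv] using h' 0 0 Y
    refine LinearMap.finrank_le_finrank_of_injective (f := (LinearMap.snd K _ _ ∘ₗ
      LinearMap.snd K _ _ ∘ₗ (e.symm : L →ₗ[K] Matrix ι ι K × Matrix ι ι K × H)).restrict
        (q := coadjointStabilizer φ) fun x hx => ?_) ?_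
    · obtain ⟨⟨a, v, X⟩, rfl⟩ := e.surjective x
      simpa using (hst a v X hx).2.2
    · rw [← LinearMap.ker_eq_bot, LinearMap.ker_eq_bot']
      rintro ⟨x, hx⟩ h0
      obtain ⟨⟨a, v, X⟩, rfl⟩ := e.surjective x
      have hX : X = 0 := by simpa using congrArg Subtype.val h0
      obtain ⟨h1, h2, -⟩ := hst a v X hx
      subst hX
      rw [map_zero] at h1
      subst h1 h2
      exact Subtype.ext (map_zero e)
  · classical
    -- the form with `β = 1`, and its other components zero, points in a good direction
    let G : Dual K (Matrix ι ι K × Matrix ι ι K × H) :=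
      LinearMap.coprod 0 (LinearMap.coprod (Matrix.traceLinearMap ι K K) 0)
    obtain ⟨α, hα⟩ := exists_eq_trace_mul (f ∘ₗ E ∘ₗ LinearMap.inl K _ _)
    obtain ⟨β, hβ⟩ := exists_eq_trace_mul
      (f ∘ₗ E ∘ₗ LinearMap.inr K _ _ ∘ₗ LinearMap.inl K _ _)
    let φ : Dual K H := f ∘ₗ E ∘ₗ LinearMap.inr K _ _ ∘ₗ LinearMap.inr K _ _
    have hf : ∀ a v X, f (e (a, v, X)) = (α * a).trace + (β * v).trace + φ X := by
      intro a v X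
      rw [← hα, ← hβ]
      simp [φ, E, ← map_add]
    refine ⟨G ∘ₗ E', ?_⟩
    -- the component of `f + t • g` on the ideal is `β + t`, which is singular for finitely many `t`
    refine ((-β).charpoly.roots.toFinset.finite_toSet).subset fun t ht => ?_
    simp only [Finset.mem_coe, Multiset.mem_toFinset, mem_roots (Matrix.charpoly_monic _).ne_zero,
      IsRoot.def, Matrix.eval_charpoly]
    by_contra hdet
    refine ht ?_
    set γ : Matrix ι ι K := Matrix.scalar ι t - -β with hγ
    have hu : IsUnit γ.det := isUnit_iff_ne_zero.2 hdet
    have h1 : γ * γ⁻¹ = 1 := Matrix.mul_nonsing_inv γ hu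
    have h2 : γ⁻¹ * γ = 1 := Matrix.nonsing_inv_mul γ hu
    set f' := f + t • (G ∘ₗ E') with hf'
    have hf1 : ∀ a v X, f' (e (a, v, X)) = (α * a).trace + (γ * v).trace + φ X := by
      intro a v X
      simp [hf', hf, E', G, hγ, add_mul, ← Matrix.smul_one_eq_diagonal]
      ring
    let φ' : Dual K H := φ + traceMulForm K (γ⁻¹ * α * γ) ∘ₗ ρ
    refine (lieIndex_le φ').trans ?_
    -- the section of the projection to `H` which maps the stabilizer of `φ'` into that of `f'`
    let s : H →ₗ[K] L := E ∘ₗ LinearMap.prod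
      (LinearMap.mulLeft K γ ∘ₗ LinearMap.mulRight K γ⁻¹ ∘ₗ ρ) (LinearMap.prod
      (LinearMap.mulRight K γ⁻¹ ∘ₗ (LinearMap.mulRight K (γ⁻¹ * α * γ) -
        LinearMap.mulLeft K (γ⁻¹ * α * γ)) ∘ₗ ρ) LinearMap.id)
    have hs : ∀ X, s X = e (γ * (ρ X * γ⁻¹),
        (ρ X * (γ⁻¹ * α * γ) - γ⁻¹ * α * γ * ρ X) * γ⁻¹, X) := fun X => rfl
    refine LinearMap.finrank_le_finrank_of_injective (f := s.restrict fun X hX => ?_) ?_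
    · rw [hs, mem_coadjointStabilizer, e.surjective.forall]
      rintro ⟨b, w, Y⟩
      have hXY := hX Y
      simp only [φ', LinearMap.add_apply, LinearMap.comp_apply, hρ, traceMulForm_apply] at hXY
      rw [he, hf1, trace_identity_of_conj h2, add_comm]
      exact hXY
    · intro x y hxy
      have : s x = s y := congrArg Subtype.val hxy
      rw [hs, hs, e.injective.eq_iff] at this
      exact Subtype.ext (congrArg (fun z => z.2.2) this)

/-! ### Matrices supported on a transitive relation -/

section RelLieSubalgebra

/-- The Lie algebra of the matrices whose nonzero entries lie at places `(i, j)` with `r i j`, for a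
transitive relation `r`. -/
def relLieSubalgebra (K : Type*) {ι : Type*} [Field K] [Fintype ι] [DecidableEq ι]
    (r : ι → ι → Prop) (hr : ∀ i j k, r i j → r j k → r i k) :
    LieSubalgebra K (Matrix ι ι K) where
  carrier := {M | ∀ i j, ¬ r i j → M i j = 0}
  zero_mem' := fun _ _ _ => rfl
  add_mem' := by
    intro M N hM hN i j hij
    rw [Matrix.add_apply, hM i j hij, hN i j hij, add_zero]
  smul_mem' := by
    intro t M hM i j hij
    rw [Matrix.smul_apply, hM i j hij, smul_zero]
  lie_mem' := by
    have hmul : ∀ M N : Matrix ι ι K, (∀ i j, ¬ r i j → M i j = 0) →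
        (∀ i j, ¬ r i j → N i j = 0) → ∀ i j, ¬ r i j → (M * N) i j = 0 := by
      intro M N hM hN i j hij
      rw [Matrix.mul_apply]
      refine Finset.sum_eq_zero fun k _ => ?_
      by_cases hik : r i k
      · rw [hN k j fun hkj => hij (hr i k j hik hkj), mul_zero]
      · rw [hM i k hik, zero_mul]
    intro M N hM hN i j hij
    rw [Ring.lie_def, Matrix.sub_apply, hmul M N hM hN i j hij, hmul N M hN hM i j hij, sub_zero]

variable {K : Type*} [Field K] {ι κ α γ : Type*} [Fintype ι] [DecidableEq ι] [Fintype κ]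
  [DecidableEq κ] [Fintype α] [DecidableEq α] [Fintype γ] [DecidableEq γ]

theorem lieIndex_relLieSubalgebra_congr (e : ι ≃ κ) {r : ι → ι → Prop}
    {hr : ∀ i j k, r i j → r j k → r i k} {s : κ → κ → Prop}
    {hs : ∀ i j k, s i j → s j k → s i k} (h : ∀ i j, r i j ↔ s (e i) (e j)) :
    lieIndex K (relLieSubalgebra K r hr) = lieIndex K (relLieSubalgebra K s hs) := by
  refine (LieEquiv.ofSubalgebras _ _ (Matrix.reindexLieEquiv e) ?_).lieIndex_eq
  ext M
  rw [LieSubalgebra.mem_map]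
  constructor
  · rintro ⟨N, hN, rfl⟩ i j hij
    exact hN _ _ (by rwa [h, e.apply_symm_apply, e.apply_symm_apply])
  · intro hM
    refine ⟨M.submatrix e e, fun i j hij => hM _ _ (by rwa [← h]), ?_⟩
    change Matrix.reindex e e (M.submatrix e e) = M
    ext i j
    simp

/-- Negated transposition reverses the relation and preserves the index. -/
theorem lieIndex_relLieSubalgebra_flip {r : ι → ι → Prop}
    {hr : ∀ i j k, r i j → r j k → r i k} {s : ι → ι → Prop}
    {hs : ∀ i j k, s i j → s j k → s i k} (h : ∀ i j, r i j ↔ s j i) :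
    lieIndex K (relLieSubalgebra K r hr) = lieIndex K (relLieSubalgebra K s hs) := by
  let e : relLieSubalgebra K r hr ≃ₗ⁅K⁆ relLieSubalgebra K s hs :=
    { toFun := fun M => ⟨-M.1.transpose, fun i j hij => by
        simp [M.2 j i (by rwa [h])]⟩
      invFun := fun M => ⟨-M.1.transpose, fun i j hij => by
        simp [M.2 j i (by rwa [← h])]⟩
      left_inv := fun M => by simp
      right_inv := fun M => by simp
      map_add' := fun M N => Subtype.ext (by simp [add_comm])
      map_smul' := fun t M => Subtype.ext (by simp)
      map_lie' := fun {M N} => Subtype.ext (by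
        simp [Ring.lie_def, Matrix.transpose_mul]) }
  exact e.lieIndex_eq

/-- A full diagonal block which is not related to the remaining rows and columns splits off. -/
theorem lieIndex_relLieSubalgebra_sum {r : α ⊕ γ → α ⊕ γ → Prop}
    {hr : ∀ i j k, r i j → r j k → r i k} {s : γ → γ → Prop}
    {hs : ∀ i j k, s i j → s j k → s i k} (h₁₁ : ∀ i j, r (.inl i) (.inl j))
    (h₁₂ : ∀ i j, ¬ r (.inl i) (.inr j)) (h₂₁ : ∀ i j, ¬ r (.inr i) (.inl j))
    (h₂₂ : ∀ i j, r (.inr i) (.inr j) ↔ s i j) :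
    lieIndex K (relLieSubalgebra K r hr) =
      lieIndex K (Matrix α α K) + lieIndex K (relLieSubalgebra K s hs) := by
  let e : (Matrix α α K × relLieSubalgebra K s hs) ≃ₗ[K] relLieSubalgebra K r hr :=
    { toFun := fun x => ⟨Matrix.fromBlocks x.1 0 0 x.2.1, by
        rintro (i | i) (j | j) hij
        · exact absurd (h₁₁ i j) hij
        · rfl
        · rfl
        · exact x.2.2 i j (by rwa [← h₂₂])⟩
      invFun := fun M => (M.1.toBlocks₁₁, ⟨M.1.toBlocks₂₂, fun i j hij =>
        M.2 _ _ (by rwa [h₂₂])⟩)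
      left_inv := fun x => by simp
      right_inv := by
        rintro ⟨M, hM⟩
        refine Subtype.ext ?_
        ext (i | i) (j | j)
        · rfl
        · exact (hM _ _ (h₁₂ i j)).symm
        · exact (hM _ _ (h₂₁ i j)).symm
        · rfl
      map_add' := fun x y => Subtype.ext (by simp [Matrix.fromBlocks_add])
      map_smul' := fun t x => Subtype.ext (by simp [Matrix.fromBlocks_smul]) }
  refine lieIndex_of_prod e fun x y => Subtype.ext ?_
  change ⁅Matrix.fromBlocks x.1 0 0 x.2.1, Matrix.fromBlocks y.1 0 0 y.2.1⁆ =
    Matrix.fromBlocks ⁅x.1, y.1⁆ 0 0 (⁅x.2, y.2⁆ : relLieSubalgebra K s hs).1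
  ext (i | i) (j | j) <;> simp [Ring.lie_def, Matrix.fromBlocks_multiply]

/-- A full diagonal block whose only other nonzero entries lie in the rows of a second block of
the same size may be deleted, provided that the columns of the second block vanish in the
remaining rows. -/
theorem lieIndex_relLieSubalgebra_sum_sum [Infinite K] {r : α ⊕ (α ⊕ γ) → α ⊕ (α ⊕ γ) → Prop}
    {hr : ∀ i j k, r i j → r j k → r i k} {s : α ⊕ γ → α ⊕ γ → Prop}
    {hs : ∀ i j k, s i j → s j k → s i k} (h₁₁ : ∀ i j, r (.inl i) (.inl j))
    (h₁₂ : ∀ i j, ¬ r (.inl i) (.inr j)) (h₂₁ : ∀ i j, r (.inr (.inl i)) (.inl j))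
    (h₃₁ : ∀ i j, ¬ r (.inr (.inr i)) (.inl j))
    (h₂₂ : ∀ i j, r (.inr i) (.inr j) ↔ s i j) (h₃₂ : ∀ i j, ¬ s (.inr i) (.inl j)) :
    lieIndex K (relLieSubalgebra K r hr) = lieIndex K (relLieSubalgebra K s hs) := by
  let e : (Matrix α α K × Matrix α α K × relLieSubalgebra K s hs) ≃ₗ[K]
      relLieSubalgebra K r hr :=
    { toFun := fun x => ⟨Matrix.fromBlocks x.1 0 (Matrix.fromRows x.2.1 0) x.2.2.1, by
        rintro (i | i) (j | j) hij
        · exact absurd (h₁₁ i j) hij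
        · rfl
        · rcases i with i | i
          · exact absurd (h₂₁ i j) hij
          · rfl
        · exact x.2.2.2 i j (by rwa [← h₂₂])⟩
      invFun := fun M => (M.1.toBlocks₁₁, M.1.toBlocks₂₁.toRows₁, ⟨M.1.toBlocks₂₂,
        fun i j hij => M.2 _ _ (by rwa [h₂₂])⟩)
      left_inv := fun x => by simp
      right_inv := by
        rintro ⟨M, hM⟩
        refine Subtype.ext ?_
        ext (i | i) (j | j)
        · rfl
        · exact (hM _ _ (h₁₂ i j)).symm
        · rcases i with i | i
          · rfl
          · exact (hM _ _ (h₃₁ i j)).symm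
        · rfl
      map_add' := fun x y => Subtype.ext (by
        ext (i | i | i) (j | j) <;> simp)
      map_smul' := fun t x => Subtype.ext (by
        ext (i | i | i) (j | j) <;> simp) }
  have hmul : ∀ (X : relLieSubalgebra K s hs) (w : Matrix α α K),
      X.1 * (Matrix.fromRows w 0 : Matrix (α ⊕ γ) α K) =
        (Matrix.fromRows (X.1.toBlocks₁₁ * w) 0 : Matrix (α ⊕ γ) α K) := by
    rintro ⟨X, hX⟩ w
    ext (i | i) j
    · simp [Matrix.mul_apply, Matrix.toBlocks₁₁]
    · simp [Matrix.mul_apply, hX _ _ (h₃₂ i _)]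
  refine lieIndex_of_semidirect
    { toFun := fun X => X.1.toBlocks₁₁
      map_add' := fun X Y => rfl
      map_smul' := fun t X => rfl } ?_ e ?_
  · intro X Y
    ext i j
    change (X.1 * Y.1 - Y.1 * X.1) (.inl i) (.inl j) = _
    simp [Matrix.mul_apply, X.2 _ _ (h₃₂ _ _), Y.2 _ _ (h₃₂ _ _), Matrix.toBlocks₁₁]
  · intro a v X b w Y
    refine Subtype.ext ?_
    change ⁅Matrix.fromBlocks a 0 (Matrix.fromRows v 0) X.1,
        Matrix.fromBlocks b 0 (Matrix.fromRows w 0) Y.1⁆ =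
      Matrix.fromBlocks (a * b - b * a) 0 (Matrix.fromRows (v * b + X.1.toBlocks₁₁ * w - w * a -
        Y.1.toBlocks₁₁ * v) 0) (X.1 * Y.1 - Y.1 * X.1)
    simp only [Ring.lie_def, Matrix.fromBlocks_multiply, hmul, Matrix.fromRows_mul]
    ext (i | i | i) (j | j) <;> (simp; try ring)

end RelLieSubalgebra

/-! ### Seaweed algebras described by lists of block sizes -/

/-- The number of the block containing position `i`, for consecutive blocks of the sizes listed in
`l`. -/
def blockOf : List ℕ → ℕ → ℕ
  | [], _ => 0
  | a :: l, i => if i < a then 0 else blockOf l (i - a) + 1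

theorem blockOf_cons_of_lt {a i : ℕ} (l : List ℕ) (h : i < a) : blockOf (a :: l) i = 0 := by
  simp [blockOf, h]

theorem blockOf_cons_add (a : ℕ) (l : List ℕ) (i : ℕ) :
    blockOf (a :: l) (a + i) = blockOf l i + 1 := by
  simp [blockOf]

theorem blockOf_add_cons_add (a b : ℕ) (l : List ℕ) (i : ℕ) :
    blockOf ((a + b) :: l) (a + i) = blockOf (b :: l) i := by
  simp [blockOf, Nat.add_sub_add_left]

theorem blockOf_mono (l : List ℕ) {i j : ℕ} (h : i ≤ j) : blockOf l i ≤ blockOf l j := by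
  induction l generalizing i j with
  | nil => exact le_rfl
  | cons a l ih =>
    have := ih (Nat.sub_le_sub_right h a)
    simp only [blockOf]
    split_ifs <;> omega

theorem sum_take_blockOf {l : List ℕ} {i : ℕ} (h : i < l.sum) :
    (l.take (blockOf l i)).sum ≤ i ∧ i < (l.take (blockOf l i + 1)).sum := by
  induction l generalizing i with
  | nil => simp at h
  | cons a l ih =>
    rcases lt_or_ge i a with hi | hi
    · simp [blockOf_cons_of_lt l hi, hi]
    · obtain ⟨k, rfl⟩ := Nat.exists_eq_add_of_le hi
      rw [List.sum_cons] at h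
      have := @ih k (by omega)
      rw [blockOf_cons_add, List.take_succ_cons, List.take_succ_cons, List.sum_cons, List.sum_cons]
      omega

theorem Composition.val_index {n : ℕ} (c : Composition n) (i : Fin n) :
    (c.index i : ℕ) = blockOf c.blocks i := by
  obtain ⟨h1, h2⟩ := sum_take_blockOf (l := c.blocks) (i := i) (by rw [c.blocks_sum]; exact i.2)
  have h3 := c.sizeUpTo_index_le i
  have h4 := c.lt_sizeUpTo_index_succ i
  change c.sizeUpTo _ ≤ _ at h1
  change _ < c.sizeUpTo _ at h2
  refine le_antisymm ?_ ?_
  · by_contra hlt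
    exact absurd ((h2.trans_le (c.monotone_sizeUpTo (not_le.1 hlt))).trans_le h3) (lt_irrefl _)
  · by_contra hlt
    exact absurd ((h4.trans_le (c.monotone_sizeUpTo (not_le.1 hlt))).trans_le h1) (lt_irrefl _)

/-- The places `(i, j)` at which matrices in the seaweed algebra with block sizes `u` above and
`l` below the diagonal may have a nonzero entry. -/
def SeaweedRel (u l : List ℕ) (i j : ℕ) : Prop :=
  (i < j → blockOf u i = blockOf u j) ∧ (j < i → blockOf l i = blockOf l j)

theorem SeaweedRel.trans {u l : List ℕ} {i j k : ℕ} (h₁ : SeaweedRel u l i j)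
    (h₂ : SeaweedRel u l j k) : SeaweedRel u l i k := by
  obtain ⟨a1, a2⟩ := h₁
  obtain ⟨b1, b2⟩ := h₂
  have m := fun (w : List ℕ) {x y : ℕ} (h : x ≤ y) => blockOf_mono w h
  constructor
  · intro hik
    rcases lt_trichotomy i j with h | rfl | h
    · rcases lt_trichotomy j k with h' | rfl | h'
      · exact (a1 h).trans (b1 h')
      · exact a1 h
      · have := m u hik.le
        have := m u h'.le
        have := a1 h
        omega
    · exact b1 hik
    · have := m u hik.le
      have := m u h.le
      have := b1 (h.trans hik)
      omega
  · intro hki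
    rcases lt_trichotomy j i with h | rfl | h
    · rcases lt_trichotomy k j with h' | rfl | h'
      · exact (a2 h).trans (b2 h')
      · exact a2 h
      · have := m l hki.le
        have := m l h'.le
        have := a2 h
        omega
    · exact b2 hki
    · have := m l hki.le
      have := m l h.le
      have := b2 (hki.trans h)
      omega

theorem SeaweedRel.flip {u l : List ℕ} {i j : ℕ} :
    SeaweedRel u l i j ↔ SeaweedRel l u j i := by
  simp only [SeaweedRel, eq_comm]
  tauto

/-- The seaweed algebra of `n × n` matrices with block sizes `u` above and `l` below the
diagonal. -/
def listSeaweed (K : Type*) [Field K] (u l : List ℕ) (n : ℕ) :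
    LieSubalgebra K (Matrix (Fin n) (Fin n) K) :=
  relLieSubalgebra K (fun i j => SeaweedRel u l i j) fun _ _ _ => SeaweedRel.trans

theorem Meander.seaweed_eq (K : Type*) [Field K] {n : ℕ} (m : Meander n) :
    m.seaweed K = listSeaweed K m.upper.blocks m.lower.blocks n := by
  ext M
  change m.HasShape M ↔ ∀ i j : Fin n, ¬ SeaweedRel _ _ i j → M i j = 0
  simp only [Meander.HasShape, Fin.ext_iff, Composition.val_index, SeaweedRel, Fin.lt_def]
  constructor
  · rintro ⟨h1, h2⟩ i j hij
    by_contra hM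
    exact hij ⟨fun h => h1 i j h hM, fun h => h2 i j h hM⟩
  · intro h
    exact ⟨fun i j hij hM => (not_imp_comm.1 (h i j) hM).1 hij,
      fun i j hij hM => (not_imp_comm.1 (h i j) hM).2 hij⟩

section

variable (K : Type*) [Field K]

theorem lieIndex_listSeaweed_zero (u l : List ℕ) : lieIndex K (listSeaweed K u l 0) = 0 :=
  Nat.le_zero.1 ((lieIndex_le 0).trans (by simp [finrank_zero_of_subsingleton]))

theorem lieIndex_listSeaweed_comm (u l : List ℕ) (n : ℕ) :
    lieIndex K (listSeaweed K u l n) = lieIndex K (listSeaweed K l u n) :=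
  lieIndex_relLieSubalgebra_flip fun _ _ => SeaweedRel.flip

/-- Equal leading parts `a` split off a summand `𝔤𝔩_a`. -/
theorem lieIndex_listSeaweed_cons_cons [CharZero K] (a : ℕ) (u l : List ℕ) (n : ℕ) :
    lieIndex K (listSeaweed K (a :: u) (a :: l) (a + n)) = a + lieIndex K (listSeaweed K u l n) := by
  have hr : ∀ i j k : Fin a ⊕ Fin n,
      SeaweedRel (a :: u) (a :: l) (finSumFinEquiv i) (finSumFinEquiv j) →
      SeaweedRel (a :: u) (a :: l) (finSumFinEquiv j) (finSumFinEquiv k) →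
      SeaweedRel (a :: u) (a :: l) (finSumFinEquiv i) (finSumFinEquiv k) :=
    fun _ _ _ => SeaweedRel.trans
  have h1 : lieIndex K (listSeaweed K (a :: u) (a :: l) (a + n)) =
      lieIndex K (relLieSubalgebra K _ hr) :=
    (lieIndex_relLieSubalgebra_congr finSumFinEquiv fun _ _ => Iff.rfl).symm
  rw [h1, lieIndex_relLieSubalgebra_sum, lieIndex_matrix]
  · rfl
  · intro i j
    simp [SeaweedRel, blockOf_cons_of_lt]
  · intro i j h
    have := h.1 (by simp; omega)
    simp [blockOf_cons_of_lt, blockOf_cons_add] at this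
  · intro i j h
    have := h.2 (by simp; omega)
    simp [blockOf_cons_of_lt, blockOf_cons_add] at this
  · intro i j
    simp [SeaweedRel, blockOf_cons_add]

/-- If the first part of one composition is half the first part of the other one, the first
block of the former may be deleted: it corresponds to a bundle of end nodes of the meander
graph. -/
theorem lieIndex_listSeaweed_cons_add_cons [CharZero K] (a : ℕ) (u l : List ℕ) (n : ℕ) :
    lieIndex K (listSeaweed K (a :: u) ((a + a) :: l) (a + (a + n))) =
      lieIndex K (listSeaweed K u (a :: l) (a + n)) := by
  let e : Fin a ⊕ (Fin a ⊕ Fin n) ≃ Fin (a + (a + n)) :=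
    (Equiv.sumCongr (Equiv.refl _) finSumFinEquiv).trans finSumFinEquiv
  have hr : ∀ i j k : Fin a ⊕ (Fin a ⊕ Fin n),
      SeaweedRel (a :: u) ((a + a) :: l) (e i) (e j) →
      SeaweedRel (a :: u) ((a + a) :: l) (e j) (e k) →
      SeaweedRel (a :: u) ((a + a) :: l) (e i) (e k) :=
    fun _ _ _ => SeaweedRel.trans
  have hs : ∀ i j k : Fin a ⊕ Fin n,
      SeaweedRel u (a :: l) (finSumFinEquiv i) (finSumFinEquiv j) →
      SeaweedRel u (a :: l) (finSumFinEquiv j) (finSumFinEquiv k) →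
      SeaweedRel u (a :: l) (finSumFinEquiv i) (finSumFinEquiv k) :=
    fun _ _ _ => SeaweedRel.trans
  have h1 : lieIndex K (listSeaweed K (a :: u) ((a + a) :: l) (a + (a + n))) =
      lieIndex K (relLieSubalgebra K _ hr) :=
    (lieIndex_relLieSubalgebra_congr e fun _ _ => Iff.rfl).symm
  have h2 : lieIndex K (listSeaweed K u (a :: l) (a + n)) =
      lieIndex K (relLieSubalgebra K _ hs) :=
    (lieIndex_relLieSubalgebra_congr finSumFinEquiv fun _ _ => Iff.rfl).symm
  have el : ∀ i, (e (.inl i) : ℕ) = i := fun i => rfl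
  have er : ∀ i, (e (.inr i) : ℕ) = a + (finSumFinEquiv i : ℕ) := fun i => rfl
  rw [h1, h2]
  apply lieIndex_relLieSubalgebra_sum_sum
  · intro i j
    have := i.2
    have := j.2
    constructor <;> intro <;> rw [el, el, blockOf_cons_of_lt _ (by omega),
      blockOf_cons_of_lt _ (by omega)]
  · intro i j h
    have := h.1 (by rw [el, er]; omega)
    rw [el, er, blockOf_cons_of_lt _ i.2, blockOf_cons_add] at this
    omega
  · intro i j
    have := i.2
    have := j.2
    rw [er, el, finSumFinEquiv_apply_left, Fin.val_castAdd]
    refine ⟨fun h => by omega, fun _ => ?_⟩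
    rw [blockOf_cons_of_lt _ (by omega), blockOf_cons_of_lt _ (by omega)]
  · intro i j h
    have := j.2
    have := h.2 (by rw [el, er]; omega)
    rw [el, er, blockOf_add_cons_add, finSumFinEquiv_apply_right, Fin.val_natAdd,
      blockOf_cons_add, blockOf_cons_of_lt _ (by omega)] at this
    omega
  · intro i j
    simp [SeaweedRel, er, blockOf_cons_add, blockOf_add_cons_add]
  · intro i j h
    have := h.2 (by simp; omega)
    simp [blockOf_cons_of_lt, blockOf_cons_add] at this

end

/-- The index of the meander with parts `u / l`, if each part is one of two numbers `c` and `2 * c`: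
equal leading parts are removed and counted, and of two different leading parts the smaller one
is removed and subtracted from the larger one. The difference is the smaller part. -/
def reductionIndex : List ℕ → List ℕ → ℕ
  | a :: u, b :: l =>
    if a = b then a + reductionIndex u l
    else if a < b then reductionIndex u (a :: l)
    else reductionIndex (b :: u) l
  | [], _ => 0
  | _ :: _, [] => 0
termination_by u l => u.length + l.length

theorem lieIndex_listSeaweed (K : Type*) [Field K] [CharZero K] (c : ℕ) (u l : List ℕ) (n : ℕ)
    (hu : ∀ b ∈ u, b = c ∨ b = 2 * c) (hl : ∀ b ∈ l, b = c ∨ b = 2 * c) (hun : u.sum = n)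
    (hln : l.sum = n) : lieIndex K (listSeaweed K u l n) = reductionIndex u l := by
  induction u, l using reductionIndex.induct generalizing n with
  | case1 u b l ih =>
    simp only [List.forall_mem_cons, List.sum_cons] at hu hl hun hln
    subst hun
    rw [lieIndex_listSeaweed_cons_cons, ih _ hu.2 hl.2 rfl (by omega), reductionIndex, if_pos rfl]
  | case2 a u b l hne hlt ih =>
    simp only [List.forall_mem_cons, List.sum_cons] at hu hl hun hln
    obtain rfl : b = a + a := by omega
    rw [add_assoc] at hln
    subst hln
    rw [lieIndex_listSeaweed_cons_add_cons, reductionIndex, if_neg hne, if_pos hlt]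
    exact ih _ hu.2 (by simp only [List.forall_mem_cons]; exact ⟨hu.1, hl.2⟩) (by omega) (by simp)
  | case3 a u b l hne hlt ih =>
    simp only [List.forall_mem_cons, List.sum_cons] at hu hl hun hln
    obtain rfl : a = b + b := by omega
    rw [add_assoc] at hun
    subst hun
    rw [lieIndex_listSeaweed_comm, lieIndex_listSeaweed_cons_add_cons, reductionIndex, if_neg hne,
      if_neg hlt, lieIndex_listSeaweed_comm]
    exact ih _ (by simp only [List.forall_mem_cons]; exact ⟨hl.1, hu.2⟩) hl.2 (by simp) (by omega)
  | case4 l =>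
    subst hun
    rw [reductionIndex]
    exact lieIndex_listSeaweed_zero K _ _
  | case5 a u =>
    subst hln
    rw [reductionIndex]
    exact lieIndex_listSeaweed_zero K _ _

theorem Meander.index_eq_reductionIndex (K : Type*) [Field K] [CharZero K] {n c : ℕ}
    (m : Meander n) (h : m.PartsIn {c, 2 * c}) :
    m.index K = reductionIndex m.upper.blocks m.lower.blocks := by
  rw [Meander.index, Meander.seaweed_eq]
  exact lieIndex_listSeaweed K c _ _ n h.1 h.2 m.upper.blocks_sum m.lower.blocks_sum

/-! ### Counting meanders with parts `c` and `2 * c` -/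

theorem reductionIndex_comm (u l : List ℕ) : reductionIndex u l = reductionIndex l u := by
  induction u, l using reductionIndex.induct with
  | case1 u b l ih => rw [reductionIndex, reductionIndex, if_pos rfl, if_pos rfl, ih]
  | case2 a u b l hne hlt ih =>
    rw [reductionIndex, reductionIndex, if_neg hne, if_pos hlt, if_neg (Ne.symm hne),
      if_neg hlt.not_gt, ih]
  | case3 a u b l hne hlt ih =>
    rw [reductionIndex, reductionIndex, if_neg hne, if_neg hlt, if_neg (Ne.symm hne),
      if_pos (by omega), ih]
  | case4 l => cases l <;> simp [reductionIndex]
  | case5 a u => simp [reductionIndex]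

theorem reductionIndex_map_mul {c : ℕ} (hc : 1 ≤ c) (u l : List ℕ) :
    reductionIndex (u.map (c * ·)) (l.map (c * ·)) = c * reductionIndex u l := by
  have hinj : ∀ a b, c * a = c * b ↔ a = b := fun a b => Nat.mul_right_inj (by omega)
  have hlt' : ∀ a b, c * a < c * b ↔ a < b := fun a b => Nat.mul_lt_mul_left (by omega)
  induction u, l using reductionIndex.induct with
  | case1 u b l ih =>
    rw [List.map_cons, List.map_cons, reductionIndex, reductionIndex, if_pos rfl, if_pos rfl, ih,
      mul_add]
  | case2 a u b l hne hlt ih =>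
    rw [List.map_cons, List.map_cons, reductionIndex, reductionIndex, if_neg hne, if_pos hlt,
      if_neg (by rwa [hinj]), if_pos (by rwa [hlt']), ← ih, List.map_cons]
  | case3 a u b l hne hlt ih =>
    rw [List.map_cons, List.map_cons, reductionIndex, reductionIndex, if_neg hne, if_neg hlt,
      if_neg (by rwa [hinj]), if_neg (by rwa [hlt']), ← ih, List.map_cons]
  | case4 l => simp [reductionIndex]
  | case5 a u => simp [reductionIndex]

/-- The compositions of `n` with parts `1` and `2`, as lists. -/
def oneTwoLists : ℕ → Finset (List ℕ)
  | 0 => {[]}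
  | 1 => {[1]}
  | n + 2 => (oneTwoLists (n + 1)).map ⟨List.cons 1, List.cons_injective⟩ ∪
      (oneTwoLists n).map ⟨List.cons 2, List.cons_injective⟩

theorem mem_oneTwoLists {n : ℕ} {l : List ℕ} :
    l ∈ oneTwoLists n ↔ (∀ b ∈ l, b = 1 ∨ b = 2) ∧ l.sum = n := by
  induction n using oneTwoLists.induct generalizing l with
  | case1 =>
    rcases l with _ | ⟨a, l⟩
    · simp [oneTwoLists]
    · simp only [oneTwoLists, Finset.mem_singleton, List.forall_mem_cons, List.sum_cons]
      constructor
      · simp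
      · omega
  | case2 =>
    rcases l with _ | ⟨a, _ | ⟨b, l⟩⟩
    · simp [oneTwoLists]
    · simp [oneTwoLists]
      omega
    · simp only [oneTwoLists, Finset.mem_singleton, List.forall_mem_cons, List.sum_cons]
      constructor
      · simp
      · omega
  | case3 n ih1 ih2 =>
    rcases l with _ | ⟨a, l⟩
    · simp [oneTwoLists]
    · simp only [oneTwoLists, Finset.mem_union, Finset.mem_map, Function.Embedding.coeFn_mk,
        List.cons.injEq, List.forall_mem_cons, List.sum_cons, ih1, ih2]
      constructor
      · rintro (⟨l, ⟨h1, h2⟩, rfl, rfl⟩ | ⟨l, ⟨h1, h2⟩, rfl, rfl⟩)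
        · exact ⟨⟨.inl rfl, h1⟩, by omega⟩
        · exact ⟨⟨.inr rfl, h1⟩, by omega⟩
      · rintro ⟨⟨rfl | rfl, h1⟩, h2⟩
        · exact .inl ⟨l, ⟨h1, by omega⟩, rfl, rfl⟩
        · exact .inr ⟨l, ⟨h1, by omega⟩, rfl, rfl⟩

theorem sum_oneTwoLists_add_two {M : Type*} [AddCommMonoid M] (f : List ℕ → M) (n : ℕ) :
    ∑ l ∈ oneTwoLists (n + 2), f l =
      ∑ l ∈ oneTwoLists (n + 1), f (1 :: l) + ∑ l ∈ oneTwoLists n, f (2 :: l) := by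
  rw [oneTwoLists, Finset.sum_union, Finset.sum_map, Finset.sum_map]
  · rfl
  · rw [Finset.disjoint_left]
    intro l h1 h2
    simp only [Finset.mem_map, Function.Embedding.coeFn_mk] at h1 h2
    obtain ⟨a, -, rfl⟩ := h1
    obtain ⟨b, -, h⟩ := h2
    simp at h

/-- The number of pairs of compositions of `n` with parts `1` and `2` and with index `k`. -/
def oneTwoCount (n k : ℕ) : ℕ :=
  ((oneTwoLists n ×ˢ oneTwoLists n).filter fun p => reductionIndex p.1 p.2 = k).card

/-- A list of numbers each of which is `c` or `2 * c` is `c` times a list of ones and twos. -/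
theorem exists_map_mul_eq {c : ℕ} {l : List ℕ} (h : ∀ b ∈ l, b = c ∨ b = 2 * c) :
    ∃ l' : List ℕ, (∀ b ∈ l', b = 1 ∨ b = 2) ∧ l'.map (c * ·) = l := by
  induction l with
  | nil => exact ⟨[], by simp, rfl⟩
  | cons a l ih =>
    rw [List.forall_mem_cons] at h
    obtain ⟨l', h1, rfl⟩ := ih h.2
    rcases h.1 with rfl | rfl
    · exact ⟨1 :: l', by simpa using h1, by simp⟩
    · exact ⟨2 :: l', by simpa using h1, by simp [mul_comm]⟩

section

variable (K : Type*) [Field K] [CharZero K]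

/-- Meanders with parts `c` and `2 * c` are those with parts `1` and `2` scaled by `c`, and scaling
multiplies the index by `c`. -/
theorem meanderCount_mul_mul {c : ℕ} (hc : 1 ≤ c) (n k : ℕ) :
    meanderCount K {c, 2 * c} (c * n) (c * k) = oneTwoCount n k := by
  let g : Meander (c * n) → List ℕ × List ℕ := fun m => (m.upper.blocks, m.lower.blocks)
  have hg : Function.Injective g := by
    rintro ⟨a, b⟩ ⟨a', b'⟩ h
    obtain ⟨h1, h2⟩ := Prod.mk.inj h
    exact congrArg₂ Meander.mk (Composition.ext h1) (Composition.ext h2)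
  have hmap : Function.Injective (List.map (c * ·) : List ℕ → List ℕ) :=
    List.map_injective_iff.2 fun a b h => Nat.eq_of_mul_eq_mul_left hc h
  rw [meanderCount, oneTwoCount, ← Set.ncard_image_of_injective _ hg,
    ← Finset.card_image_of_injective _ (hmap.prodMap hmap), ← Set.ncard_coe_finset]
  congr 1
  have hsum : ∀ u : List ℕ, (u.map (c * ·)).sum = c * u.sum := fun u => by
    rw [List.sum_map_mul_left, List.map_id']
  have hpart : ∀ u : List ℕ, (∀ b ∈ u, b = 1 ∨ b = 2) →
      ∀ b ∈ u.map (c * ·), b ∈ ({c, 2 * c} : Set ℕ) := by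
    intro u hu b hb
    obtain ⟨a, ha, rfl⟩ := List.mem_map.1 hb
    rcases hu a ha with rfl | rfl
    · left; simp
    · right; simp [mul_comm]
  ext ⟨u, l⟩
  simp only [Set.mem_image, Finset.coe_image, Finset.coe_filter, Finset.mem_product,
    Prod.exists, Set.mem_ofPred_eq, Prod.map_apply, Prod.mk.injEq, mem_oneTwoLists]
  constructor
  · rintro ⟨m, ⟨hm, hk⟩, h⟩
    obtain ⟨rfl, rfl⟩ := Prod.mk.inj h
    rw [m.index_eq_reductionIndex K hm] at hk
    obtain ⟨u, hu, hu'⟩ := exists_map_mul_eq hm.1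
    obtain ⟨l, hl, hl'⟩ := exists_map_mul_eq hm.2
    have h1 := m.upper.blocks_sum
    have h2 := m.lower.blocks_sum
    rw [← hu', hsum] at h1
    rw [← hl', hsum] at h2
    rw [← hu', ← hl', reductionIndex_map_mul hc] at hk
    exact ⟨u, l, ⟨⟨⟨hu, Nat.eq_of_mul_eq_mul_left hc h1⟩, ⟨hl, Nat.eq_of_mul_eq_mul_left hc h2⟩⟩,
      Nat.eq_of_mul_eq_mul_left hc hk⟩, hu', hl'⟩
  · rintro ⟨u, l, ⟨⟨⟨hu, hun⟩, ⟨hl, hln⟩⟩, hk⟩, rfl, rfl⟩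
    have hpos : ∀ u : List ℕ, (∀ b ∈ u, b = 1 ∨ b = 2) → ∀ {b}, b ∈ u.map (c * ·) → 0 < b := by
      intro u hu b hb
      rcases hpart u hu b hb with rfl | rfl <;> omega
    let m : Meander (c * n) := ⟨⟨u.map (c * ·), hpos u hu, by rw [hsum, hun]⟩,
      ⟨l.map (c * ·), hpos l hl, by rw [hsum, hln]⟩⟩
    have hm : m.PartsIn {c, 2 * c} := ⟨hpart u hu, hpart l hl⟩
    refine ⟨m, ⟨hm, ?_⟩, rfl⟩
    rw [m.index_eq_reductionIndex K hm, ← hk]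
    exact reductionIndex_map_mul hc u l

theorem dvd_of_meanderCount_ne_zero {c n k : ℕ} (hc : 1 ≤ c)
    (h : meanderCount K {c, 2 * c} n k ≠ 0) : c ∣ n ∧ c ∣ k := by
  obtain ⟨m, hm, hk⟩ := Set.nonempty_of_ncard_ne_zero h
  rw [m.index_eq_reductionIndex K hm] at hk
  obtain ⟨u, -, hu'⟩ := exists_map_mul_eq hm.1
  obtain ⟨l, -, hl'⟩ := exists_map_mul_eq hm.2
  rw [← hu', ← hl', reductionIndex_map_mul hc] at hk
  have h1 := m.upper.blocks_sum
  rw [← hu', List.sum_map_mul_left] at h1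
  exact ⟨⟨_, h1.symm⟩, ⟨_, hk.symm⟩⟩

theorem meanderCount_one_two (n k : ℕ) : meanderCount K {1, 2} n k = oneTwoCount n k := by
  simpa using meanderCount_mul_mul K le_rfl n k

end

/-! ### The generating function -/

/-- The generating polynomial, in the index, of pairs of compositions of `n` with parts `1` and
`2`. -/
noncomputable def oneTwoPoly (n : ℕ) : ℚ[X] :=
  ∑ u ∈ oneTwoLists n, ∑ l ∈ oneTwoLists n, X ^ reductionIndex u l

/-- The part of `oneTwoPoly (n + 1)` that comes from the pairs whose second composition begins
with `1`. -/
noncomputable def oneTwoPolyOne (n : ℕ) : ℚ[X] :=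
  ∑ u ∈ oneTwoLists (n + 1), ∑ l ∈ oneTwoLists n, X ^ reductionIndex u (1 :: l)

theorem coeff_oneTwoPoly (n k : ℕ) : (oneTwoPoly n).coeff k = oneTwoCount n k := by
  rw [oneTwoPoly, ← Finset.sum_product', finsetSum_coeff, oneTwoCount, Finset.card_filter,
    Nat.cast_sum]
  simp [coeff_X_pow, eq_comm]

theorem reductionIndex_one_one (u l : List ℕ) :
    reductionIndex (1 :: u) (1 :: l) = 1 + reductionIndex u l := by
  simp [reductionIndex]

theorem reductionIndex_two_two (u l : List ℕ) :
    reductionIndex (2 :: u) (2 :: l) = 2 + reductionIndex u l := by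
  simp [reductionIndex]

theorem reductionIndex_one_two (u l : List ℕ) :
    reductionIndex (1 :: u) (2 :: l) = reductionIndex u (1 :: l) := by
  simp [reductionIndex]

theorem reductionIndex_two_one (u l : List ℕ) :
    reductionIndex (2 :: u) (1 :: l) = reductionIndex l (1 :: u) := by
  rw [reductionIndex_comm, reductionIndex_one_two]

theorem oneTwoPoly_zero : oneTwoPoly 0 = 1 := by
  simp [oneTwoPoly, oneTwoLists, reductionIndex]

theorem oneTwoPoly_one : oneTwoPoly 1 = X := by
  simp [oneTwoPoly, oneTwoLists, reductionIndex]

theorem oneTwoPolyOne_zero : oneTwoPolyOne 0 = X := by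
  simp [oneTwoPolyOne, oneTwoLists, reductionIndex]

theorem oneTwoPolyOne_succ (n : ℕ) :
    oneTwoPolyOne (n + 1) = X * oneTwoPoly (n + 1) + oneTwoPolyOne n := by
  simp only [oneTwoPolyOne, oneTwoPoly, sum_oneTwoLists_add_two, reductionIndex_one_one,
    reductionIndex_two_one, pow_add, pow_one, ← Finset.mul_sum]
  congr 1
  rw [Finset.sum_comm]

theorem oneTwoPoly_add_two (n : ℕ) :
    oneTwoPoly (n + 2) =
      X * oneTwoPoly (n + 1) + X ^ 2 * oneTwoPoly n + 2 * oneTwoPolyOne n := by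
  simp only [oneTwoPolyOne, oneTwoPoly, sum_oneTwoLists_add_two, reductionIndex_one_one,
    reductionIndex_two_one, reductionIndex_one_two, reductionIndex_two_two, pow_add, pow_one,
    ← Finset.mul_sum, Finset.sum_add_distrib]
  rw [Finset.sum_comm (s := oneTwoLists n) (t := oneTwoLists (n + 1))]
  ring

/-- The power series in two variables whose coefficient at `x ^ n y ^ k` is the coefficient of
`p n` at `k`. -/
def seriesOfPolys (p : ℕ → ℚ[X]) : MvPowerSeries (Fin 2) ℚ :=
  fun e => (p (e 0)).coeff (e 1)

theorem coeff_seriesOfPolys (p : ℕ → ℚ[X]) (e : Fin 2 →₀ ℕ) :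
    MvPowerSeries.coeff e (seriesOfPolys p) = (p (e 0)).coeff (e 1) := rfl

theorem X_zero_mul_seriesOfPolys (p : ℕ → ℚ[X]) :
    MvPowerSeries.X 0 * seriesOfPolys p = seriesOfPolys fun n => n.casesOn 0 p := by
  ext e
  rw [MvPowerSeries.X, MvPowerSeries.coeff_monomial_mul, one_mul]
  simp only [coeff_seriesOfPolys]
  split_ifs with h
  · have h0 : 1 ≤ e 0 := by simpa using h 0
    obtain ⟨n, hn⟩ := Nat.exists_eq_add_of_le' h0
    simp [hn]
  · have h0 : e 0 = 0 := by
      by_contra h0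
      refine h (Finsupp.single_le_iff.2 (by omega))
    simp [h0]

theorem X_one_mul_seriesOfPolys (p : ℕ → ℚ[X]) :
    MvPowerSeries.X 1 * seriesOfPolys p = seriesOfPolys fun n => X * p n := by
  ext e
  rw [MvPowerSeries.X, MvPowerSeries.coeff_monomial_mul, one_mul]
  simp only [coeff_seriesOfPolys]
  split_ifs with h
  · have h0 : 1 ≤ e 1 := by simpa using h 1
    obtain ⟨n, hn⟩ := Nat.exists_eq_add_of_le' h0
    simp [hn]
  · have h0 : e 1 = 0 := by
      by_contra h0
      refine h (Finsupp.single_le_iff.2 (by omega))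
    simp [h0]

theorem seriesOfPolys_add (p q : ℕ → ℚ[X]) :
    seriesOfPolys p + seriesOfPolys q = seriesOfPolys fun n => p n + q n := by
  ext e
  simp [coeff_seriesOfPolys]

theorem one_eq_seriesOfPolys : 1 = seriesOfPolys fun n => n.casesOn 1 fun _ => 0 := by
  ext e
  rw [coeff_seriesOfPolys, MvPowerSeries.coeff_one]
  rcases h0 : e 0 with _ | n
  · simp [coeff_one, Finsupp.ext_iff, Fin.forall_fin_two, h0, eq_comm]
  · rw [if_neg (fun h => by simp [h] at h0)]
    simp

theorem seriesOfPolys_oneTwoPolyOne {x y : MvPowerSeries (Fin 2) ℚ} (hx : x = MvPowerSeries.X 0)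
    (hy : y = MvPowerSeries.X 1) :
    seriesOfPolys oneTwoPolyOne =
      y * seriesOfPolys oneTwoPoly + x * seriesOfPolys oneTwoPolyOne := by
  rw [hx, hy, X_zero_mul_seriesOfPolys, X_one_mul_seriesOfPolys, seriesOfPolys_add]
  congr 1
  funext n
  rcases n with _ | n
  · simp [oneTwoPolyOne_zero, oneTwoPoly_zero]
  · exact oneTwoPolyOne_succ n

theorem seriesOfPolys_oneTwoPoly {x y : MvPowerSeries (Fin 2) ℚ} (hx : x = MvPowerSeries.X 0)
    (hy : y = MvPowerSeries.X 1) :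
    seriesOfPolys oneTwoPoly =
      1 + x * (y * seriesOfPolys oneTwoPoly) + x * (x * (y * (y * seriesOfPolys oneTwoPoly))) +
        x * (x * (seriesOfPolys oneTwoPolyOne + seriesOfPolys oneTwoPolyOne)) := by
  rw [hx, hy, one_eq_seriesOfPolys]
  simp only [X_zero_mul_seriesOfPolys, X_one_mul_seriesOfPolys, seriesOfPolys_add]
  congr 1
  funext n
  rcases n with _ | _ | n
  · simp [oneTwoPoly_zero]
  · simp [oneTwoPoly_one, oneTwoPoly_zero]
  · simp only [oneTwoPoly_add_two]
    ring

theorem meanderGF_one_two (K : Type*) [Field K] [CharZero K] :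
    meanderGF K {1, 2} = seriesOfPolys oneTwoPoly := by
  funext e
  rw [meanderGF, seriesOfPolys, coeff_oneTwoPoly, meanderCount_one_two]

/-- Substituting `x ^ c` and `y ^ c` spreads the coefficients to the multiples of `c`. -/
theorem coeff_subst_pow_pow {c : ℕ} (hc : 1 ≤ c) (f : MvPowerSeries (Fin 2) ℚ)
    (e : Fin 2 →₀ ℕ) :
    MvPowerSeries.coeff e (MvPowerSeries.subst
      (![MvPowerSeries.X 0 ^ c, MvPowerSeries.X 1 ^ c] : Fin 2 → MvPowerSeries (Fin 2) ℚ) f) =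
      ∑ᶠ d : Fin 2 →₀ ℕ, if e = c • d then MvPowerSeries.coeff d f else 0 := by
  have ha : (![MvPowerSeries.X 0 ^ c, MvPowerSeries.X 1 ^ c] :
      Fin 2 → MvPowerSeries (Fin 2) ℚ) = fun i => MvPowerSeries.X i ^ c := by
    funext i
    fin_cases i <;> rfl
  rw [ha, MvPowerSeries.coeff_subst (MvPowerSeries.HasSubst.X_pow (by omega))]
  refine finsum_congr fun d => ?_
  have h : (d.prod fun s n => ((MvPowerSeries.X s : MvPowerSeries (Fin 2) ℚ) ^ c) ^ n) =
      MvPowerSeries.monomial (c • d) 1 := by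
    rw [MvPowerSeries.monomial_one_eq, Finsupp.prod_fintype _ _ (by simp),
      Finsupp.prod_fintype _ _ (by simp)]
    simp [pow_mul]
  rw [h, MvPowerSeries.coeff_monomial]
  split_ifs <;> simp

theorem mainTheorem3 (K : Type*) [Field K] [CharZero K]
    (x y : MvPowerSeries (Fin 2) ℚ) (hx : x = MvPowerSeries.X 0) (hy : y = MvPowerSeries.X 1) :
    meanderGF K {1, 2} =
        (1 - x) * ((1 - x * y - x ^ 2 * y ^ 2) * (1 - x) - 2 * x ^ 2 * y)⁻¹ ∧
      ∀ c : ℕ, 1 ≤ c →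
        meanderGF K {c, 2 * c} = MvPowerSeries.subst ![x ^ c, y ^ c] (meanderGF K {1, 2}) := by
  constructor
  · rw [meanderGF_one_two, MvPowerSeries.eq_mul_inv_iff_mul_eq]
    · have h1 := seriesOfPolys_oneTwoPoly hx hy
      have h2 := seriesOfPolys_oneTwoPolyOne hx hy
      linear_combination (1 - x) * h1 + 2 * x ^ 2 * h2
    · simp [hx, hy]
  · intro c hc
    subst hx hy
    ext e
    rw [coeff_subst_pow_pow hc]
    by_cases h : c ∣ e 0 ∧ c ∣ e 1
    · obtain ⟨⟨n, hn⟩, ⟨k, hk⟩⟩ := h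
      let d : Fin 2 →₀ ℕ := Finsupp.equivFunOnFinite.symm ![n, k]
      have hd : e = c • d := by
        ext i
        fin_cases i
        · exact hn
        · exact hk
      have huniq : ∀ d', e = c • d' → d' = d := by
        intro d' h
        ext i
        have := DFunLike.congr_fun (h.symm.trans hd) i
        exact Nat.eq_of_mul_eq_mul_left hc this
      rw [finsum_eq_single _ d fun d' hd' => if_neg fun h => hd' (huniq d' h), if_pos hd]
      change (meanderCount K {c, 2 * c} (e 0) (e 1) : ℚ) = (meanderCount K {1, 2} n k : ℚ)
      rw [hn, hk, meanderCount_mul_mul K hc, meanderCount_one_two]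
    · have h0 : meanderCount K {c, 2 * c} (e 0) (e 1) = 0 := by
        by_contra hne
        exact h (dvd_of_meanderCount_ne_zero K hc hne)
      rw [finsum_eq_zero_of_forall_eq_zero]
      · change (meanderCount K {c, 2 * c} (e 0) (e 1) : ℚ) = 0
        rw [h0, Nat.cast_zero]
      · intro d
        refine if_neg fun hd => h ?_
        rw [hd]
        exact ⟨⟨_, rfl⟩, ⟨_, rfl⟩⟩
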